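/- Write $\widehat{\mathbb C}=\mathbb C\cup\{\infty\}$ and let $d\ge 1$. For $f=\sum_{0\le i,j\le d}A_{(i,j)}x^iy^j\in\mathbb C[x,y]$ let $$F([\xi:x],[\zeta:y])=\sum_{0\le i,j\le d}A_{(i,j)}\,x^i\xi^{d-i}y^j\zeta^{d-j}$$ and let $\Gamma_f\subset\widehat{\mathbb C}\times\widehat{\mathbb C}$ be the zero set of $F$, where $x\in\mathbb C$ is identified with $[1:x]$ and $\infty$ with $[0:1]$. We call $f$ a correspondence of degree $d$ if (i) for all but finitely many $x_0\in\mathbb C$ the polynomial $f(x_0,\cdot)$ has exactly $d$ zeros in $\mathbb C$ counted with multiplicity, and likewise for $f(\cdot,y_0)$ for all but finitely many $y_0\in\mathbb C$; and (ii) $\Gamma_f$ contains no set $\{a\}\times\widehat{\mathbb C}$ or $\widehat{\mathbb C}\times\{a\}$ with $a\in\widehat{\mathbb C}$. For $x_1\in\widehat{\mathbb C}$ let $Y_f(x_1)$ be the multiset of the $d$ zeros in $\widehat{\mathbb C}$ of the binary form $F(x_1,\cdot)$ of degree $d$, counted with multiplicity, and for $y_1\in\widehat{\mathbb C}$ let $X_f(y_1)$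 be the multiset of the $d$ zeros of $F(\cdot,y_1)$. A correspondence $f$ of degree $d$ is called a map of $d$-tuples if for every $x_1\in\widehat{\mathbb C}$ the multisets $X_f(y)$, $y\in Y_f(x_1)$, all coincide, and for every $y_1\in\widehat{\mathbb C}$ the multisets $Y_f(x)$, $x\in X_f(y_1)$, all coincide. **Theorem.** Let $d\ge 2$ and let $f_d=\sum_{0\le i,j\le d}A_{(i,j)}x^iy^j\in\mathbb C[x,y]$ be a correspondence of degree $d$. Then $f_d$ is a map of $d$-tuples if and only if at least one of the following holds: 1. $f_d=g_k^{\,d/k}$ for some divisor $k$ of $d$ with $k\neq d$ and some $g_k\in\mathbb C[x,y]$ that is a map of $k$-tuples; 2. the $(d+1)\times(d+1)$ matrix $\big(A_{(d-r,\,d-c)}\big)_{0\le r,c\le d}$ of coefficients of $f_d$ has rank exactly $2$. -/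

import Mathlib

open Polynomial
open scoped Polynomial.Bivariate

namespace TupleCorrespondence

noncomputable section

/-- The coefficient `A_(i, j)` of `x ^ i * y ^ j` in `f ∈ ℂ[x, y]`. The ring `ℂ[x, y]` is
`ℂ[X][Y]`: the inner variable is `x`, the outer variable is `y`. -/
def coef (f : ℂ[X][Y]) (i j : ℕ) : ℂ := (f.coeff j).coeff i

/-- Homogeneous coordinates `[ξ : x]` of a point of the Riemann sphere: a complex number `x` is
`[1 : x]` and the point at infinity is `[0 : 1]`. -/
def homCoord : OnePoint ℂ → ℂ × ℂ
  | none => (0, 1)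
  | some x => (1, x)

/-- The bihomogenisation `F([ξ : x], [ζ : y])` of bidegree `(d, d)`, evaluated at
`u = (ξ, x)` and `v = (ζ, y)`. -/
def bihomog (d : ℕ) (f : ℂ[X][Y]) (u v : ℂ × ℂ) : ℂ :=
  ∑ i ∈ Finset.range (d + 1), ∑ j ∈ Finset.range (d + 1),
    coef f i j * (u.2 ^ i * u.1 ^ (d - i)) * (v.2 ^ j * v.1 ^ (d - j))

/-- The biprojective completion `Γ_f` of `{f = 0}` in the product of two Riemann spheres. -/
def completion (d : ℕ) (f : ℂ[X][Y]) : Set (OnePoint ℂ × OnePoint ℂ) :=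
  {p | bihomog d f (homCoord p.1) (homCoord p.2) = 0}

/-- `f` is a polynomial correspondence of degree `d`: `f(x, ·)` and `f(·, y)` are generically
`d`-valued (values counted with multiplicity), and the completion of `{f = 0}` has no component
`{a} × Ĉ` or `Ĉ × {a}`. (The completion is a curve, so such a line is an irreducible component
exactly when it is contained in the completion.) -/
structure IsCorrespondence (d : ℕ) (f : ℂ[X][Y]) : Prop where
  generic_left : ∀ᶠ x : ℂ in Filter.cofinite,
    Multiset.card (f.map (evalRingHom x)).roots = d
  generic_right : ∀ᶠ y : ℂ in Filter.cofinite,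
    Multiset.card (f.eval (C y)).roots = d
  no_vertical : ∀ a : OnePoint ℂ, ¬ ({a} ×ˢ Set.univ ⊆ completion d f)
  no_horizontal : ∀ a : OnePoint ℂ, ¬ (Set.univ ×ˢ {a} ⊆ completion d f)

/-- The zeros on the Riemann sphere, with multiplicity, of the binary form
`∑ j ≤ d, c_j t ^ j s ^ (d - j)` of degree `d` attached to a nonzero polynomial
`P = ∑ j ≤ d, c_j t ^ j`. The order of vanishing at infinity `s = 0` is `d - deg P`. -/
def sphereRoots (d : ℕ) (P : ℂ[X]) : Multiset (OnePoint ℂ) :=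
  P.roots.map (fun z : ℂ => (z : OnePoint ℂ)) +
    Multiset.replicate (d - P.natDegree) OnePoint.infty

/-- The restriction of the bihomogenisation to `{p} × Ĉ`, as a polynomial in the affine
coordinate `y` (that is, with `ζ = 1`). -/
def sliceLeft (d : ℕ) (f : ℂ[X][Y]) (p : OnePoint ℂ) : ℂ[X] :=
  ∑ j ∈ Finset.range (d + 1),
    C (∑ i ∈ Finset.range (d + 1),
      coef f i j * ((homCoord p).2 ^ i * (homCoord p).1 ^ (d - i))) * X ^ j

/-- The restriction of the bihomogenisation to `Ĉ × {q}`, as a polynomial in the affine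
coordinate `x` (that is, with `ξ = 1`). -/
def sliceRight (d : ℕ) (f : ℂ[X][Y]) (q : OnePoint ℂ) : ℂ[X] :=
  ∑ i ∈ Finset.range (d + 1),
    C (∑ j ∈ Finset.range (d + 1),
      coef f i j * ((homCoord q).2 ^ j * (homCoord q).1 ^ (d - j))) * X ^ i

/-- The list of points `y` of `Γ_f` above `x = p`, repeated according to the intersection
multiplicity of `{p} × Ĉ` with `Γ_f`. -/
def imageList (d : ℕ) (f : ℂ[X][Y]) (p : OnePoint ℂ) : Multiset (OnePoint ℂ) :=
  sphereRoots d (sliceLeft d f p)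

/-- The list of points `x` of `Γ_f` above `y = q`, repeated according to the intersection
multiplicity of `Ĉ × {q}` with `Γ_f`. -/
def preimageList (d : ℕ) (f : ℂ[X][Y]) (q : OnePoint ℂ) : Multiset (OnePoint ℂ) :=
  sphereRoots d (sliceRight d f q)

/-- The degree `d` correspondence `f` is a map of `d`-tuples: for every `x₁`, the lists of
preimages of the images `y_j` of `x₁` coincide, and symmetrically for every `y₁`. -/
structure IsMapOfTuples (d : ℕ) (f : ℂ[X][Y]) : Prop where
  isCorrespondence : IsCorrespondence d f
  left : ∀ x₁ : OnePoint ℂ, ∀ y ∈ imageList d f x₁, ∀ y' ∈ imageList d f x₁,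
    preimageList d f y = preimageList d f y'
  right : ∀ y₁ : OnePoint ℂ, ∀ x ∈ preimageList d f y₁, ∀ x' ∈ preimageList d f y₁,
    imageList d f x = imageList d f x'

/-- The `(d + 1) × (d + 1)` matrix of coefficients, with `A_(d, d)` in the top left corner and
`A_(0, 0)` in the bottom right corner. -/
def coeffMatrix (d : ℕ) (f : ℂ[X][Y]) : Matrix (Fin (d + 1)) (Fin (d + 1)) ℂ :=
  Matrix.of fun r c => coef f (d - (r : ℕ)) (d - (c : ℕ))

end

end TupleCorrespondence

/-!
Let `ν` be the Veronese map of degree `d` and `A` the coefficient matrix of `f`, so that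
`F(u, v) = ν(u)ᵀ A ν(v)`. If `rank A ≤ 2`, the vectors `A ν(y)` with `y ∈ Y(x₁)` lie in the range of
`A` and in the kernel of the functional `ν(x₁)ᵀ`, which is nonzero on that range; hence they are
proportional, and the multisets `X(y)` coincide.

Conversely, let `f` be a map of `d`-tuples. If `p(x₁, y) = 0` for an irreducible factor `p` of `f`
and a generic `x₁`, then `x₁` occurs in `X(y)` with the multiplicity of `p` in `f`, so all the
irreducible factors have the same multiplicity `e`, and `f` is an `e`-th power. If `e = 1`, a
generic `x₁` has `d` distinct images `yᵢ`; the vectors `ν(yᵢ)` are linearly independent and `A`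
maps them into a line, so `rank A ≤ 2`. A matrix of rank at most `1` would make `F` a product of a
form in `u` and a form in `v`, and `Γ_f` would contain a line.
-/

namespace TupleCorrespondence

open Polynomial.Bivariate Filter Matrix

section Bivariate

lemma coeff_coeff_swap {R : Type*} [CommSemiring R] (f : R[X][Y]) (i j : ℕ) :
    ((swap f).coeff j).coeff i = (f.coeff i).coeff j := by
  induction f using Polynomial.induction_on' with
  | add p q hp hq => simp [hp, hq]
  | monomial n a =>
    induction a using Polynomial.induction_on' with
    | add p q hp hq => simp_all only [map_add, coeff_add]
    | monomial m r =>
      rw [swap_monomial_monomial]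
      simp only [coeff_monomial]
      split_ifs <;> simp_all only [coeff_monomial, if_true, if_false, coeff_zero]

lemma natDegree_coeff_le_natDegree_swap {R : Type*} [CommSemiring R] {f : R[X][Y]} {j : ℕ} :
    (f.coeff j).natDegree ≤ (swap f).natDegree := by
  refine natDegree_le_iff_coeff_eq_zero.2 fun i hi => ?_
  rw [← coeff_coeff_swap, coeff_eq_zero_of_natDegree_lt hi, coeff_zero]

lemma map_evalRingHom_swap {R : Type*} [CommSemiring R] (f : R[X][Y]) (x : R) :
    (swap f).map (evalRingHom x) = f.eval (C x) := by
  have h : (mapRingHom (evalRingHom x)).comp (swap (R := R)).toRingHom = evalRingHom (C x) := by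
    ext : 3 <;> simp [swap_C_C, swap_X, swap_Y]
  exact DFunLike.congr_fun h f

lemma evalEval_swap {R : Type*} [CommSemiring R] (f : R[X][Y]) (x y : R) :
    (swap f).evalEval x y = f.evalEval y x := by
  rw [← map_evalRingHom_eval, map_evalRingHom_swap]

lemma irreducible_swap {R : Type*} [CommSemiring R] {p : R[X][Y]} (hp : Irreducible p) :
    Irreducible (swap p) :=
  (MulEquiv.irreducible_iff (swap (R := R))).2 hp

variable {R : Type*} [CommRing R] [IsDomain R]

lemma eventually_eval_ne_zero {p : R[X]} (hp : p ≠ 0) : ∀ᶠ x in cofinite, p.eval x ≠ 0 := by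
  refine eventually_cofinite.2 ((finite_setOfPred_isRoot hp).subset fun x hx => ?_)
  exact not_not.1 hx

lemma eventually_natDegree_map {f : R[X][Y]} (hf : f ≠ 0) :
    ∀ᶠ x in cofinite, (f.map (evalRingHom x)).natDegree = f.natDegree := by
  filter_upwards [eventually_eval_ne_zero (leadingCoeff_ne_zero.2 hf)] with x hx
  exact natDegree_map_of_leadingCoeff_ne_zero _ hx

lemma eventually_exists_evalEval_eq_zero {K : Type*} [Field K] [IsAlgClosed K] {p : K[X][Y]}
    (hp : p.natDegree ≠ 0) : ∀ᶠ x in cofinite, ∃ y, p.evalEval x y = 0 := by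
  filter_upwards [eventually_natDegree_map (ne_zero_of_natDegree_gt (Nat.pos_of_ne_zero hp))]
    with x hx
  obtain ⟨y, hy⟩ := IsAlgClosed.exists_root (p.map (evalRingHom x))
    fun h => hp (hx ▸ natDegree_eq_of_degree_eq_some h)
  exact ⟨y, by rwa [← map_evalRingHom_eval]⟩

lemma eventually_forall_evalEval_ne_zero {p : R[X][Y]} (hp : p ≠ 0) (hp0 : p.natDegree = 0) :
    ∀ᶠ x in cofinite, ∀ y, p.evalEval x y ≠ 0 := by
  obtain ⟨r, rfl⟩ := natDegree_eq_zero.1 hp0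
  filter_upwards [eventually_eval_ne_zero (C_ne_zero.1 hp)] with x hx y
  rwa [evalEval_C]

/- The resultant of `p` and `q` with respect to `y` is a nonzero polynomial in `x` that vanishes at
the abscissa of every common zero. -/
lemma eventually_evalEval_ne_zero [UniqueFactorizationMonoid R] {p q : R[X][Y]}
    (hp : Irreducible p) (hp0 : p.natDegree ≠ 0) (hpq : ¬ p ∣ q) :
    ∀ᶠ x in cofinite, ∀ y, p.evalEval x y = 0 → q.evalEval x y ≠ 0 := by
  let F := FractionRing R[X]
  have hprim := hp.isPrimitive hp0
  have hirr := (hprim.irreducible_iff_irreducible_map_fraction_map (K := F)).1 hp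
  have hcop : IsCoprime (p.map (algebraMap R[X] F)) (q.map (algebraMap R[X] F)) :=
    (hirr.isCoprime_or_dvd _).resolve_right fun h =>
      hpq (hprim.dvd_of_fraction_map_dvd_fraction_map h)
  have hinj := IsFractionRing.injective R[X] F
  have hres : p.resultant q ≠ 0 := by
    have h := resultant_ne_zero _ _ hcop
    rw [natDegree_map_eq_of_injective hinj, natDegree_map_eq_of_injective hinj,
      resultant_map_map] at h
    exact fun h0 => h (by rw [h0, map_zero])
  obtain ⟨a, b, -, -, hab⟩ := exists_mul_add_mul_eq_C_resultant p q le_rfl le_rfl (Or.inl hp0)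
  filter_upwards [eventually_eval_ne_zero hres] with x hx y hpxy hqxy
  apply hx
  rw [← evalEval_C x y, ← hab, evalEval_add, evalEval_mul, evalEval_mul, hpxy, hqxy, zero_mul,
    zero_mul, add_zero]

end Bivariate

section RootMultiplicity

lemma rootMultiplicity_pow_mul {R : Type*} [CommRing R] [IsDomain R] {p q : R[X]} {a : R}
    (hp : p.IsRoot a) (hp' : ¬ (derivative p).IsRoot a) (hq : ¬ q.IsRoot a) (e : ℕ) :
    (p ^ e * q).rootMultiplicity a = e := by
  classical
  have hp0 : p ≠ 0 := fun h => hp' (by simp [h])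
  have hq0 : q ≠ 0 := fun h => hq (by simp [h])
  have hsimple : p.rootMultiplicity a = 1 :=
    le_antisymm (not_lt.1 fun h => hp' ((one_lt_rootMultiplicity_iff_isRoot hp0).1 h).2)
      ((rootMultiplicity_pos hp0).2 hp)
  rw [rootMultiplicity_mul (mul_ne_zero (pow_ne_zero e hp0) hq0), ← count_roots (p ^ e),
    roots_pow, Multiset.count_nsmul, count_roots, hsimple, rootMultiplicity_eq_zero hq, mul_one,
    add_zero]

variable {R : Type*} [CommRing R] [IsDomain R] [UniqueFactorizationMonoid R] {p f : R[X][Y]}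

open UniqueFactorizationMonoid in
lemma exists_mem_factors_evalEval_eq_zero (hf : f ≠ 0) {x y : R} (h : f.evalEval x y = 0) :
    ∃ p ∈ factors f, p.evalEval x y = 0 := by
  have hprod : evalEvalRingHom x y (factors f).prod = 0 :=
    ((factors_prod hf).map (evalEvalRingHom x y)).eq_zero_iff.2 h
  rw [map_multiset_prod, Multiset.prod_eq_zero_iff, Multiset.mem_map] at hprod
  exact hprod

variable [CharZero R]

lemma eventually_rootMultiplicity_map_eq (hp : Irreducible p) (hf : f ≠ 0) :
    ∀ᶠ x in cofinite, ∀ y, p.evalEval x y = 0 →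
      (f.map (evalRingHom x)).rootMultiplicity y = multiplicity p f := by
  by_cases hp0 : p.natDegree = 0
  · filter_upwards [eventually_forall_evalEval_ne_zero hp.ne_zero hp0] with x hx y hy
    exact absurd hy (hx y)
  obtain ⟨h, hfh, hph⟩ :=
    (FiniteMultiplicity.of_prime_left hp.prime hf).exists_eq_pow_mul_and_not_dvd
  have hp' : ¬ p ∣ derivative p := by rwa [dvd_derivative_iff, derivative_eq_zero]
  filter_upwards [eventually_evalEval_ne_zero hp hp0 hph, eventually_evalEval_ne_zero hp hp0 hp']
    with x hx hx' y hy
  conv_lhs => rw [hfh, Polynomial.map_mul, Polynomial.map_pow]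
  apply rootMultiplicity_pow_mul <;>
    simp only [IsRoot.def, derivative_map, map_evalRingHom_eval]
  exacts [hy, hx' y hy, hx y hy]

lemma eventually_rootMultiplicity_eval_eq (hp : Irreducible p) (hp0' : (swap p).natDegree ≠ 0)
    (hf : f ≠ 0) : ∀ᶠ x in cofinite, ∀ y, p.evalEval x y = 0 →
      (f.eval (C y)).rootMultiplicity x = multiplicity p f := by
  by_cases hp0 : p.natDegree = 0
  · filter_upwards [eventually_forall_evalEval_ne_zero hp.ne_zero hp0] with x hx y hy
    exact absurd hy (hx y)
  obtain ⟨h, hfh, hph⟩ :=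
    (FiniteMultiplicity.of_prime_left hp.prime hf).exists_eq_pow_mul_and_not_dvd
  have hp' : ¬ p ∣ swap (derivative (swap p)) := by
    rw [← map_dvd_iff (swap (R := R)), swap_swap_apply, dvd_derivative_iff]
    rwa [derivative_eq_zero]
  filter_upwards [eventually_evalEval_ne_zero hp hp0 hph, eventually_evalEval_ne_zero hp hp0 hp']
    with x hx hx' y hy
  conv_lhs => rw [hfh, eval_mul, eval_pow]
  refine rootMultiplicity_pow_mul hy ?_ (hx y hy) _
  rw [← map_evalRingHom_swap, derivative_map, IsRoot.def, map_evalRingHom_eval, ← evalEval_swap]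
  exact hx' y hy

open UniqueFactorizationMonoid in
lemma eventually_nodup_roots_map (hf : Squarefree f) :
    ∀ᶠ x in cofinite, (f.map (evalRingHom x)).roots.Nodup := by
  classical
  have hmult : ∀ᶠ x in cofinite, ∀ p ∈ (factors f).toFinset, ∀ y,
      p.evalEval x y = 0 → (f.map (evalRingHom x)).rootMultiplicity y = multiplicity p f :=
    (eventually_all_finset _).2 fun p hp => eventually_rootMultiplicity_map_eq
      (irreducible_of_factor p (Multiset.mem_toFinset.1 hp)) hf.ne_zero
  filter_upwards [hmult] with x hx
  refine Multiset.nodup_iff_count_le_one.2 fun y => ?_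
  rw [count_roots]
  by_cases hy : f.evalEval x y = 0
  · obtain ⟨p, hp, hpy⟩ := exists_mem_factors_evalEval_eq_zero hf.ne_zero hy
    rw [hx p (Multiset.mem_toFinset.2 hp) y hpy]
    exact multiplicity_le_of_emultiplicity_le <|
      ((squarefree_iff_emultiplicity_le_one f).1 hf p).resolve_right
        (irreducible_of_factor p hp).not_isUnit
  · rw [rootMultiplicity_eq_zero (by rwa [IsRoot.def, map_evalRingHom_eval])]
    exact zero_le_one

end RootMultiplicity

section PerfectPowers

variable {M : Type*} [CommMonoidWithZero M] [UniqueFactorizationMonoid M] {a : M}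

lemma squarefree_of_multiplicity_eq_one (ha : a ≠ 0)
    (h : ∀ p, Irreducible p → p ∣ a → multiplicity p a = 1) : Squarefree a := by
  refine (squarefree_iff_no_irreducibles ha).2 fun p hp hpa => ?_
  have hle := (FiniteMultiplicity.of_prime_left hp.prime ha).le_multiplicity_of_pow_dvd
    (pow_two p ▸ hpa)
  rw [h p hp (dvd_of_mul_right_dvd hpa)] at hle
  exact absurd hle (by decide)

open UniqueFactorizationMonoid in
lemma exists_associated_pow_of_multiplicity_eq (ha : a ≠ 0) {e : ℕ}
    (h : ∀ p, Irreducible p → p ∣ a → multiplicity p a = e) : ∃ b, Associated (b ^ e) a := by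
  classical
  let := UniqueFactorizationMonoid.strongNormalizationMonoid (α := M)
  have hfactors : normalizedFactors a = e • (normalizedFactors a).dedup := by
    ext p
    rw [Multiset.count_nsmul, Multiset.count_dedup]
    split_ifs with hp
    · have hirr := irreducible_of_normalized_factor p hp
      rw [mul_one, ← h p hirr (dvd_of_mem_normalizedFactors hp),
        multiplicity_eq_count_normalizedFactors hirr ha, normalize_normalized_factor p hp]
    · rw [Multiset.count_eq_zero_of_notMem hp, mul_zero]
  refine ⟨(normalizedFactors a).dedup.prod, ?_⟩
  rw [← Multiset.prod_nsmul, ← hfactors]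
  exact prod_normalizedFactors ha

variable {K : Type*} [Field K] [IsAlgClosed K]

lemma exists_pow_eq_of_isUnit {u : K[X][Y]} (hu : IsUnit u) {e : ℕ} (he : e ≠ 0) :
    ∃ v, v ^ e = u := by
  obtain ⟨r, hr, rfl⟩ := Polynomial.isUnit_iff.1 hu
  obtain ⟨c, -, rfl⟩ := Polynomial.isUnit_iff.1 hr
  obtain ⟨t, rfl⟩ := IsAlgClosed.exists_pow_nat_eq c (Nat.pos_of_ne_zero he)
  exact ⟨C (C t), by rw [C_pow, C_pow]⟩

lemma exists_eq_pow_of_multiplicity_eq {f : K[X][Y]} (hf : f ≠ 0) {e : ℕ} (he : e ≠ 0)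
    (h : ∀ p, Irreducible p → p ∣ f → multiplicity p f = e) : ∃ g, f = g ^ e := by
  obtain ⟨b, u, hu⟩ := exists_associated_pow_of_multiplicity_eq hf h
  obtain ⟨v, hv⟩ := exists_pow_eq_of_isUnit u.isUnit he
  exact ⟨b * v, by rw [mul_pow, hv, hu]⟩

end PerfectPowers

section MatrixRank

variable {K m n : Type*} [Field K] [Fintype n] {M : Matrix m n K}

lemma exists_eq_vecMulVec_of_rank_le_one (hM : M.rank ≤ 1) : ∃ a b, M = vecMulVec a b := by
  classical
  obtain ⟨a, ha⟩ := finrank_le_one_iff.1 hM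
  choose b hb using fun j => ha ⟨M *ᵥ Pi.single j 1, LinearMap.mem_range_self M.mulVecLin _⟩
  refine ⟨a, b, ?_⟩
  ext i j
  calc M i j = (M *ᵥ Pi.single j 1) i := by rw [mulVec_single_one, col_apply]
    _ = b j * (a : m → K) i := (congrFun (congrArg Subtype.val (hb j)) i).symm
    _ = vecMulVec a b i j := mul_comm _ _

lemma exists_smul_mulVec_eq_of_rank_le_two [Fintype m] (hM : M.rank ≤ 2) {u : m → K}
    (hu : u ᵥ* M ≠ 0) {v v' : n → K} (hv : u ⬝ᵥ M *ᵥ v = 0) (hv' : u ⬝ᵥ M *ᵥ v' = 0)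
    (hv0 : M *ᵥ v ≠ 0) :
    ∃ c : K, c • M *ᵥ v = M *ᵥ v' := by
  classical
  by_contra! h
  have hindep : LinearIndependent K ![M *ᵥ v, M *ᵥ v'] := (LinearIndependent.pair_iff' hv0).2 h
  have hspan : Submodule.span K (Set.range ![M *ᵥ v, M *ᵥ v']) = LinearMap.range M.mulVecLin := by
    refine Submodule.eq_of_le_of_finrank_le (Submodule.span_le.2 ?_) ?_
    · rintro _ ⟨i, rfl⟩
      fin_cases i
      exacts [⟨v, rfl⟩, ⟨v', rfl⟩]
    · rw [finrank_span_eq_card hindep]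
      exact hM
  have hker : LinearMap.range M.mulVecLin ≤ LinearMap.ker (dotProductBilin K K u) := by
    rw [← hspan, Submodule.span_le]
    rintro _ ⟨i, rfl⟩
    fin_cases i
    exacts [hv, hv']
  refine hu (dotProduct_eq_zero _ fun w => ?_)
  rw [← dotProduct_mulVec]
  exact hker ⟨w, rfl⟩

lemma rank_add_card_le_of_mulVec_mem {ι : Type*} [Fintype ι] {v : ι → n → K}
    (hv : LinearIndependent K v) {S : Submodule K (m → K)} [FiniteDimensional K S]
    (hS : ∀ i, M *ᵥ v i ∈ S) :
    M.rank + Fintype.card ι ≤ Module.finrank K S + Fintype.card n := by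
  let T := M.mulVecLin
  let W := Submodule.span K (Set.range v)
  have hW : Module.finrank K W = Fintype.card ι := finrank_span_eq_card hv
  have hrange : Module.finrank K (T.domRestrict W).range ≤ Module.finrank K S := by
    refine Submodule.finrank_mono ?_
    rw [LinearMap.range_domRestrict, Submodule.map_span_le]
    rintro _ ⟨i, rfl⟩
    exact hS i
  have hker : Module.finrank K (T.domRestrict W).ker ≤ Module.finrank K T.ker := by
    rw [LinearMap.ker_domRestrict, ← Submodule.finrank_map_subtype_eq, Submodule.map_comap_subtype]
    exact Submodule.finrank_mono inf_le_right
  have h₁ := T.finrank_range_add_finrank_ker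
  have h₂ := (T.domRestrict W).finrank_range_add_finrank_ker
  rw [Module.finrank_fintype_fun_eq_card] at h₁
  change M.rank + _ = _ at h₁
  omega

end MatrixRank

section SphereRoots

variable {d : ℕ} {P Q : ℂ[X]}

/-- The point with parameter `u` on the affine cone over the rational normal curve of degree `d`,
that is, the vector of the monomials of degree `d` evaluated at `u`. A binary form of degree `d`
with coefficient vector `w` takes the value `w ⬝ᵥ veronese d u` at `u`. -/
def veronese (d : ℕ) (u : ℂ × ℂ) : Fin (d + 1) → ℂ :=
  fun i => u.2 ^ (i : ℕ) * u.1 ^ (d - i)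

lemma natDegree_ofFn_le (w : Fin (d + 1) → ℂ) : (ofFn (d + 1) w).natDegree ≤ d :=
  Nat.lt_succ_iff.1 (ofFn_natDegree_lt d.succ_pos w)

lemma dotProduct_veronese_coe (w : Fin (d + 1) → ℂ) (y : ℂ) :
    w ⬝ᵥ veronese d (homCoord y) = (ofFn (d + 1) w).eval y := by
  rw [ofFn_eq_sum_monomial, eval_finsetSum]
  refine Finset.sum_congr rfl fun i _ => ?_
  rw [eval_monomial]
  simp [veronese, homCoord]

lemma dotProduct_veronese_infty (w : Fin (d + 1) → ℂ) :
    w ⬝ᵥ veronese d (homCoord OnePoint.infty) = (ofFn (d + 1) w).coeff d := by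
  have hv : veronese d (homCoord OnePoint.infty) = Pi.single (Fin.last d) 1 := by
    ext i
    obtain ⟨j, rfl⟩ | rfl := i.eq_castSucc_or_eq_last
    · simp [veronese, homCoord, Nat.sub_ne_zero_of_lt j.isLt, (Fin.castSucc_lt_last j).ne]
    · simp [veronese, homCoord]
  rw [hv, dotProduct_single_one, ofFn_coeff_eq_val_of_lt w d.lt_succ_self]
  rfl

lemma eq_zero_of_forall_dotProduct_veronese {w : Fin (d + 1) → ℂ}
    (h : ∀ q, w ⬝ᵥ veronese d (homCoord q) = 0) : w = 0 := by
  refine injective_ofFn (d + 1) (Polynomial.funext fun y => ?_)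
  rw [← dotProduct_veronese_coe, h, map_zero, eval_zero]

lemma coe_mem_sphereRoots (hP : P ≠ 0) {z : ℂ} :
    (z : OnePoint ℂ) ∈ sphereRoots d P ↔ P.eval z = 0 := by
  simp [sphereRoots, Multiset.mem_replicate, hP]

lemma infty_mem_sphereRoots (hP : P ≠ 0) (hd : P.natDegree ≤ d) :
    OnePoint.infty ∈ sphereRoots d P ↔ P.coeff d = 0 := by
  have hmem : OnePoint.infty ∈ sphereRoots d P ↔ P.natDegree < d := by
    simp [sphereRoots, Multiset.mem_replicate, Nat.sub_ne_zero_iff_lt]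
  rw [hmem]
  refine ⟨coeff_eq_zero_of_natDegree_lt, fun h => hd.lt_of_ne ?_⟩
  rintro rfl
  exact hP (leadingCoeff_eq_zero.1 h)

lemma mem_sphereRoots_ofFn {w : Fin (d + 1) → ℂ} (hw : w ≠ 0) (q : OnePoint ℂ) :
    q ∈ sphereRoots d (ofFn (d + 1) w) ↔ w ⬝ᵥ veronese d (homCoord q) = 0 := by
  have hw' : ofFn (d + 1) w ≠ 0 := (map_ne_zero_iff _ (injective_ofFn _)).2 hw
  induction q using OnePoint.rec with
  | infty => rw [infty_mem_sphereRoots hw' (natDegree_ofFn_le w), dotProduct_veronese_infty]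
  | coe y => rw [coe_mem_sphereRoots hw', dotProduct_veronese_coe]

lemma card_sphereRoots (hP : P.natDegree ≤ d) : Multiset.card (sphereRoots d P) = d := by
  rw [sphereRoots, Multiset.card_add, Multiset.card_map, Multiset.card_replicate,
    ← (IsAlgClosed.splits P).natDegree_eq_card_roots, Nat.add_sub_of_le hP]

lemma exists_dotProduct_veronese_eq_zero (hd : d ≠ 0) (w : Fin (d + 1) → ℂ) :
    ∃ q, w ⬝ᵥ veronese d (homCoord q) = 0 := by
  obtain rfl | hw := eq_or_ne w 0
  · exact ⟨OnePoint.infty, zero_dotProduct _⟩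
  · obtain ⟨q, hq⟩ := Multiset.card_pos_iff_exists_mem.1
      ((card_sphereRoots (natDegree_ofFn_le w)).symm ▸ Nat.pos_of_ne_zero hd)
    exact ⟨q, (mem_sphereRoots_ofFn hw q).1 hq⟩

lemma count_coe_sphereRoots [DecidableEq (OnePoint ℂ)] (d : ℕ) (P : ℂ[X]) (z : ℂ) :
    (sphereRoots d P).count (z : OnePoint ℂ) = P.rootMultiplicity z := by
  rw [sphereRoots, Multiset.count_add, Multiset.count_replicate,
    if_neg (OnePoint.coe_ne_infty z).symm, add_zero,
    Multiset.count_map_eq_count' _ _ OnePoint.coe_injective, count_roots]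

lemma sphereRoots_smul (d : ℕ) {c : ℂ} (hc : c ≠ 0) (P : ℂ[X]) :
    sphereRoots d (c • P) = sphereRoots d P := by
  rw [sphereRoots, sphereRoots, roots_smul_nonzero _ hc, natDegree_smul _ hc]

lemma sphereRoots_pow (k e : ℕ) (P : ℂ[X]) :
    sphereRoots (e * k) (P ^ e) = e • sphereRoots k P := by
  rw [sphereRoots, sphereRoots, roots_pow, natDegree_pow, ← Nat.mul_sub, Multiset.map_nsmul,
    nsmul_add, Multiset.nsmul_replicate]

lemma exists_smul_eq_of_sphereRoots_eq (hP : P ≠ 0) (hQ : Q ≠ 0)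
    (h : sphereRoots d P = sphereRoots d Q) : ∃ c : ℂ, c • P = Q := by
  classical
  have hroots : P.roots = Q.roots := by
    ext z
    rw [count_roots, count_roots, ← count_coe_sphereRoots d, h, count_coe_sphereRoots]
  obtain ⟨u, rfl⟩ := (IsAlgClosed.associated_iff_roots_eq_roots hP hQ).2 hroots
  obtain ⟨c, -, hc⟩ := Polynomial.isUnit_iff.1 u.isUnit
  exact ⟨c, by rw [← hc, smul_eq_C_mul, mul_comm]⟩

lemma linearIndependent_veronese {y : Fin d → ℂ} (hy : Function.Injective y) :
    LinearIndependent ℂ fun i => veronese d (homCoord (y i)) := by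
  have hdet : (vandermonde y).det ≠ 0 := det_vandermonde_ne_zero_iff.2 hy
  refine LinearIndependent.of_comp (LinearMap.funLeft ℂ ℂ Fin.castSucc) ?_
  have hrows : LinearMap.funLeft ℂ ℂ Fin.castSucc ∘ (fun i => veronese d (homCoord (y i))) =
      (vandermonde y).row := by
    ext i j
    simp [veronese, homCoord, LinearMap.funLeft_apply, vandermonde_apply]
  rw [hrows]
  exact linearIndependent_rows_of_det_ne_zero hdet

end SphereRoots

section Slices

variable {d : ℕ} {f : ℂ[X][Y]}

/-- The coefficients of `f` in ascending order of exponents, so that row `i` and column `j` stand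
for `x ^ i * y ^ j`. This is the matrix of the bihomogenisation of `f` as a bilinear form in the
monomials of degree `d`, see `bihomog_eq_dotProduct`. -/
noncomputable def ascCoeffMatrix (d : ℕ) (f : ℂ[X][Y]) : Matrix (Fin (d + 1)) (Fin (d + 1)) ℂ :=
  Matrix.of fun i j => coef f i j

lemma rank_coeffMatrix (d : ℕ) (f : ℂ[X][Y]) :
    (coeffMatrix d f).rank = (ascCoeffMatrix d f).rank := by
  have h : coeffMatrix d f = (ascCoeffMatrix d f).submatrix Fin.revPerm Fin.revPerm := by
    ext r c
    simp [coeffMatrix, ascCoeffMatrix, Fin.val_rev]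
  rw [h, rank_submatrix]

lemma ascCoeffMatrix_swap (d : ℕ) (f : ℂ[X][Y]) :
    ascCoeffMatrix d (swap f) = (ascCoeffMatrix d f)ᵀ := by
  ext i j
  exact coeff_coeff_swap f i j

lemma bihomog_eq_dotProduct (d : ℕ) (f : ℂ[X][Y]) (u v : ℂ × ℂ) :
    bihomog d f u v = veronese d u ⬝ᵥ ascCoeffMatrix d f *ᵥ veronese d v := by
  simp only [bihomog, dotProduct, mulVec, veronese, ascCoeffMatrix, of_apply, Finset.mul_sum,
    Finset.sum_range]
  refine Finset.sum_congr rfl fun i _ => Finset.sum_congr rfl fun j _ => ?_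
  ring

lemma sliceLeft_eq_ofFn (d : ℕ) (f : ℂ[X][Y]) (p : OnePoint ℂ) :
    sliceLeft d f p = ofFn (d + 1) (veronese d (homCoord p) ᵥ* ascCoeffMatrix d f) := by
  rw [sliceLeft, ofFn_eq_sum_monomial, Finset.sum_range]
  refine Finset.sum_congr rfl fun j _ => ?_
  rw [C_mul_X_pow_eq_monomial, Finset.sum_range, vecMul, dotProduct_comm]
  rfl

lemma sliceRight_eq_sliceLeft_swap (d : ℕ) (f : ℂ[X][Y]) (q : OnePoint ℂ) :
    sliceRight d f q = sliceLeft d (swap f) q := by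
  simp only [sliceRight, sliceLeft, coef, coeff_coeff_swap]

lemma sliceRight_eq_ofFn (d : ℕ) (f : ℂ[X][Y]) (q : OnePoint ℂ) :
    sliceRight d f q = ofFn (d + 1) (ascCoeffMatrix d f *ᵥ veronese d (homCoord q)) := by
  rw [sliceRight_eq_sliceLeft_swap, sliceLeft_eq_ofFn, ascCoeffMatrix_swap, vecMul_transpose]

lemma preimageList_eq_imageList_swap (d : ℕ) (f : ℂ[X][Y]) :
    preimageList d f = imageList d (swap f) :=
  funext fun q => congrArg (sphereRoots d) (sliceRight_eq_sliceLeft_swap d f q)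

lemma preimageList_swap (d : ℕ) (f : ℂ[X][Y]) : preimageList d (swap f) = imageList d f := by
  rw [preimageList_eq_imageList_swap, swap_swap_apply]

lemma sliceLeft_eq_zero_iff {p : OnePoint ℂ} :
    sliceLeft d f p = 0 ↔ veronese d (homCoord p) ᵥ* ascCoeffMatrix d f = 0 := by
  rw [sliceLeft_eq_ofFn, map_eq_zero_iff _ (injective_ofFn _)]

lemma sliceRight_eq_zero_iff {q : OnePoint ℂ} :
    sliceRight d f q = 0 ↔ ascCoeffMatrix d f *ᵥ veronese d (homCoord q) = 0 := by
  rw [sliceRight_eq_ofFn, map_eq_zero_iff _ (injective_ofFn _)]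

lemma sliceLeft_coe (hf : f.natDegree ≤ d) (hf' : (swap f).natDegree ≤ d) (x : ℂ) :
    sliceLeft d f x = f.map (evalRingHom x) := by
  conv_rhs => rw [f.as_sum_range_C_mul_X_pow' (Nat.lt_succ_of_le hf)]
  rw [sliceLeft, Polynomial.map_sum]
  refine Finset.sum_congr rfl fun j _ => ?_
  rw [Polynomial.map_mul, Polynomial.map_pow, map_X, map_C, coe_evalRingHom,
    eval_eq_sum_range' (Nat.lt_succ_of_le (natDegree_coeff_le_natDegree_swap.trans hf'))]
  simp [homCoord, coef]

lemma sliceLeft_infty (hf : f.natDegree ≤ d) :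
    sliceLeft d f OnePoint.infty = (swap f).coeff d := by
  have hdeg : ((swap f).coeff d).natDegree ≤ d :=
    natDegree_coeff_le_natDegree_swap.trans (by rwa [swap_swap_apply])
  rw [sliceLeft, ((swap f).coeff d).as_sum_range_C_mul_X_pow' (Nat.lt_succ_of_le hdeg)]
  refine Finset.sum_congr rfl fun j _ => ?_
  rw [coeff_coeff_swap, Finset.sum_range_succ, Finset.sum_eq_zero, zero_add]
  · simp [homCoord, coef]
  · intro i hi
    simp [homCoord, Nat.sub_ne_zero_of_lt (Finset.mem_range.1 hi)]

lemma mem_completion_iff (p q : OnePoint ℂ) : (p, q) ∈ completion d f ↔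
    veronese d (homCoord p) ⬝ᵥ ascCoeffMatrix d f *ᵥ veronese d (homCoord q) = 0 := by
  rw [← bihomog_eq_dotProduct]
  rfl

lemma vertical_subset_completion_iff (a : OnePoint ℂ) :
    {a} ×ˢ Set.univ ⊆ completion d f ↔ sliceLeft d f a = 0 := by
  rw [sliceLeft_eq_zero_iff]
  constructor
  · refine fun h => eq_zero_of_forall_dotProduct_veronese fun q => ?_
    rw [← dotProduct_mulVec, ← mem_completion_iff]
    exact h ⟨rfl, trivial⟩
  · rintro h ⟨_, q⟩ ⟨rfl, -⟩
    rw [mem_completion_iff, dotProduct_mulVec, h, zero_dotProduct]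

lemma horizontal_subset_completion_iff (a : OnePoint ℂ) :
    Set.univ ×ˢ {a} ⊆ completion d f ↔ sliceRight d f a = 0 := by
  rw [sliceRight_eq_zero_iff]
  constructor
  · refine fun h => eq_zero_of_forall_dotProduct_veronese fun p => ?_
    rw [dotProduct_comm, ← mem_completion_iff]
    exact h ⟨trivial, rfl⟩
  · rintro h ⟨p, _⟩ ⟨-, rfl⟩
    rw [mem_completion_iff, h, dotProduct_zero]

lemma mem_imageList {p q : OnePoint ℂ} (h : sliceLeft d f p ≠ 0) :
    q ∈ imageList d f p ↔ (p, q) ∈ completion d f := by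
  rw [imageList, sliceLeft_eq_ofFn, mem_sphereRoots_ofFn (mt sliceLeft_eq_zero_iff.2 h),
    mem_completion_iff, dotProduct_mulVec]

lemma isCorrespondence_iff : IsCorrespondence d f ↔
    (∀ᶠ x in cofinite, Multiset.card (f.map (evalRingHom x)).roots = d) ∧
      (∀ᶠ y in cofinite, Multiset.card (f.eval (C y)).roots = d) ∧
      (∀ a, sliceLeft d f a ≠ 0) ∧ ∀ a, sliceRight d f a ≠ 0 := by
  simp only [ne_eq, ← vertical_subset_completion_iff, ← horizontal_subset_completion_iff]
  exact ⟨fun h => ⟨h.1, h.2, h.3, h.4⟩, fun h => ⟨h.1, h.2.1, h.2.2.1, h.2.2.2⟩⟩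

end Slices

section IsCorrespondence

variable {d : ℕ} {f : ℂ[X][Y]}

lemma IsCorrespondence.sliceLeft_ne_zero (h : IsCorrespondence d f) (a : OnePoint ℂ) :
    sliceLeft d f a ≠ 0 :=
  (isCorrespondence_iff.1 h).2.2.1 a

lemma IsCorrespondence.sliceRight_ne_zero (h : IsCorrespondence d f) (a : OnePoint ℂ) :
    sliceRight d f a ≠ 0 :=
  (isCorrespondence_iff.1 h).2.2.2 a

lemma IsCorrespondence.swap (h : IsCorrespondence d f) : IsCorrespondence d (swap f) := by
  obtain ⟨hleft, hright, hvert, hhoriz⟩ := isCorrespondence_iff.1 h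
  refine isCorrespondence_iff.2 ⟨?_, ?_, ?_, ?_⟩
  · simpa only [map_evalRingHom_swap] using hright
  · simpa only [← map_evalRingHom_swap, swap_swap_apply] using hleft
  · simpa only [sliceRight_eq_sliceLeft_swap] using hhoriz
  · simpa only [sliceRight_eq_sliceLeft_swap, swap_swap_apply] using hvert

lemma IsCorrespondence.ne_zero (h : IsCorrespondence d f) : f ≠ 0 := by
  rintro rfl
  refine h.sliceLeft_ne_zero OnePoint.infty (sliceLeft_eq_zero_iff.2 ?_)
  exact vecMul_zero _

lemma IsCorrespondence.natDegree (h : IsCorrespondence d f) : f.natDegree = d := by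
  obtain ⟨x, hx, hx'⟩ := (h.generic_left.and (eventually_natDegree_map h.ne_zero)).exists
  rw [← hx', ← hx, (IsAlgClosed.splits _).natDegree_eq_card_roots]

lemma IsCorrespondence.natDegree_swap (h : IsCorrespondence d f) :
    (Bivariate.swap f).natDegree = d :=
  h.swap.natDegree

lemma IsCorrespondence.sliceLeft_coe (hf : IsCorrespondence d f) (x : ℂ) :
    sliceLeft d f x = f.map (evalRingHom x) :=
  TupleCorrespondence.sliceLeft_coe hf.natDegree.le hf.natDegree_swap.le x

lemma IsCorrespondence.sliceRight_coe (hf : IsCorrespondence d f) (y : ℂ) :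
    sliceRight d f y = f.eval (C y) := by
  rw [sliceRight_eq_sliceLeft_swap, hf.swap.sliceLeft_coe, map_evalRingHom_swap]

lemma IsCorrespondence.coe_mem_imageList (hf : IsCorrespondence d f) {x y : ℂ} :
    (y : OnePoint ℂ) ∈ imageList d f x ↔ f.evalEval x y = 0 := by
  have hx := hf.sliceLeft_ne_zero x
  rw [imageList, coe_mem_sphereRoots hx, hf.sliceLeft_coe, map_evalRingHom_eval]

end IsCorrespondence

section Powers

variable {k e : ℕ} {g : ℂ[X][Y]}

lemma sliceLeft_pow (hg : g.natDegree ≤ k) (hg' : (swap g).natDegree ≤ k) (e : ℕ)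
    (p : OnePoint ℂ) : sliceLeft (e * k) (g ^ e) p = sliceLeft k g p ^ e := by
  have h : (g ^ e).natDegree ≤ e * k := natDegree_pow_le_of_le e hg
  have h' : (swap (g ^ e)).natDegree ≤ e * k := by
    rw [map_pow]
    exact natDegree_pow_le_of_le e hg'
  induction p using OnePoint.rec with
  | infty => rw [sliceLeft_infty h, sliceLeft_infty hg, map_pow, coeff_pow_of_natDegree_le hg']
  | coe x => rw [sliceLeft_coe h h', sliceLeft_coe hg hg', Polynomial.map_pow]

lemma sliceRight_pow (hg : g.natDegree ≤ k) (hg' : (swap g).natDegree ≤ k) (e : ℕ)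
    (q : OnePoint ℂ) : sliceRight (e * k) (g ^ e) q = sliceRight k g q ^ e := by
  rw [sliceRight_eq_sliceLeft_swap, sliceRight_eq_sliceLeft_swap, map_pow,
    sliceLeft_pow hg' (by rwa [swap_swap_apply])]

lemma imageList_pow (hg : g.natDegree ≤ k) (hg' : (swap g).natDegree ≤ k) (e : ℕ)
    (p : OnePoint ℂ) : imageList (e * k) (g ^ e) p = e • imageList k g p := by
  rw [imageList, sliceLeft_pow hg hg', sphereRoots_pow, imageList]

lemma preimageList_pow (hg : g.natDegree ≤ k) (hg' : (swap g).natDegree ≤ k) (e : ℕ)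
    (q : OnePoint ℂ) : preimageList (e * k) (g ^ e) q = e • preimageList k g q := by
  rw [preimageList, sliceRight_pow hg hg', sphereRoots_pow, preimageList]

lemma isCorrespondence_pow_iff (he : e ≠ 0) :
    IsCorrespondence (e * k) (g ^ e) ↔ IsCorrespondence k g := by
  have key (hg : g.natDegree ≤ k) (hg' : (swap g).natDegree ≤ k) :
      IsCorrespondence (e * k) (g ^ e) ↔ IsCorrespondence k g := by
    simp only [isCorrespondence_iff, Polynomial.map_pow, eval_pow, roots_pow, Multiset.card_nsmul,
      mul_right_inj' he, sliceLeft_pow hg hg', sliceRight_pow hg hg', ne_eq,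
      pow_eq_zero_iff he]
  refine ⟨fun h => (key ?_ ?_).1 h, fun h => (key h.natDegree.le h.natDegree_swap.le).2 h⟩
  · exact (mul_left_cancel₀ he (by rw [← natDegree_pow, h.natDegree])).le
  · exact (mul_left_cancel₀ he (by rw [← natDegree_pow, ← map_pow, h.natDegree_swap])).le

lemma isMapOfTuples_pow_iff (he : e ≠ 0) :
    IsMapOfTuples (e * k) (g ^ e) ↔ IsMapOfTuples k g := by
  by_cases hg : IsCorrespondence k g
  · have himage := imageList_pow hg.natDegree.le hg.natDegree_swap.le e
    have hpreimage := preimageList_pow hg.natDegree.le hg.natDegree_swap.le e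
    constructor
    · rintro ⟨-, hl, hr⟩
      simp only [himage, hpreimage, nsmul_right_inj he, Multiset.mem_nsmul_of_ne_zero he] at hl hr
      exact ⟨hg, hl, hr⟩
    · rintro ⟨-, hl, hr⟩
      refine ⟨(isCorrespondence_pow_iff he).2 hg, ?_, ?_⟩ <;>
        simp only [himage, hpreimage, nsmul_right_inj he, Multiset.mem_nsmul_of_ne_zero he]
      exacts [hl, hr]
  · exact iff_of_false (fun h => hg ((isCorrespondence_pow_iff he).1 h.1)) fun h => hg h.1

end Powers

section RankTwo

variable {d : ℕ} {f : ℂ[X][Y]}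

lemma IsCorrespondence.two_le_rank (hf : IsCorrespondence d f) (hd : d ≠ 0) :
    2 ≤ (ascCoeffMatrix d f).rank := by
  by_contra! h
  obtain ⟨a, b, hab⟩ := exists_eq_vecMulVec_of_rank_le_one (Nat.le_of_lt_succ h)
  obtain ⟨p, hp⟩ := exists_dotProduct_veronese_eq_zero hd a
  apply hf.sliceLeft_ne_zero p
  rw [sliceLeft_eq_zero_iff, hab, vecMul_vecMulVec, dotProduct_comm, hp, zero_smul]

lemma IsCorrespondence.preimageList_eq_of_rank_le_two (hf : IsCorrespondence d f)
    (hr : (ascCoeffMatrix d f).rank ≤ 2) {x y y' : OnePoint ℂ} (hy : y ∈ imageList d f x)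
    (hy' : y' ∈ imageList d f x) : preimageList d f y = preimageList d f y' := by
  have hx := hf.sliceLeft_ne_zero x
  rw [mem_imageList hx, mem_completion_iff] at hy hy'
  obtain ⟨c, hc⟩ := exists_smul_mulVec_eq_of_rank_le_two hr (mt sliceLeft_eq_zero_iff.2 hx) hy hy'
    (mt sliceRight_eq_zero_iff.2 (hf.sliceRight_ne_zero y))
  have hslice : sliceRight d f y' = c • sliceRight d f y := by
    rw [sliceRight_eq_ofFn, sliceRight_eq_ofFn, ← hc, map_smul]
  have hc0 : c ≠ 0 := by
    rintro rfl
    exact hf.sliceRight_ne_zero y' (hslice.trans (zero_smul _ _))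
  rw [preimageList, preimageList, hslice, sphereRoots_smul d hc0]

lemma IsCorrespondence.isMapOfTuples_of_rank_le_two (hf : IsCorrespondence d f)
    (hr : (ascCoeffMatrix d f).rank ≤ 2) : IsMapOfTuples d f where
  isCorrespondence := hf
  left _ _ hy _ hy' := hf.preimageList_eq_of_rank_le_two hr hy hy'
  right _ x hx x' hx' := by
    rw [preimageList_eq_imageList_swap] at hx hx'
    rw [← preimageList_swap]
    exact hf.swap.preimageList_eq_of_rank_le_two
      (by rwa [ascCoeffMatrix_swap, rank_transpose]) hx hx'

lemma IsMapOfTuples.rank_le_two_of_injective (hf : IsMapOfTuples d f) (hd : d ≠ 0) {x : ℂ}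
    {y : Fin d → ℂ} (hy : Function.Injective y) (hxy : ∀ i, f.evalEval x (y i) = 0) :
    (ascCoeffMatrix d f).rank ≤ 2 := by
  have hc := hf.isCorrespondence
  let w (i : Fin d) : Fin (d + 1) → ℂ := ascCoeffMatrix d f *ᵥ veronese d (homCoord (y i))
  let i₀ : Fin d := ⟨0, Nat.pos_of_ne_zero hd⟩
  have hproportional (i : Fin d) : w i ∈ Submodule.span ℂ {w i₀} := by
    have hpre := hf.left x _ (hc.coe_mem_imageList.2 (hxy i₀)) _ (hc.coe_mem_imageList.2 (hxy i))
    obtain ⟨c, hslice⟩ := exists_smul_eq_of_sphereRoots_eq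
      (hc.sliceRight_ne_zero _) (hc.sliceRight_ne_zero _) hpre
    rw [sliceRight_eq_ofFn, sliceRight_eq_ofFn, ← map_smul] at hslice
    exact Submodule.mem_span_singleton.2 ⟨c, injective_ofFn _ hslice⟩
  have hrank := rank_add_card_le_of_mulVec_mem (linearIndependent_veronese hy) hproportional
  have hspan := finrank_span_le_card (R := ℂ) {w i₀}
  rw [Set.toFinset_singleton, Finset.card_singleton] at hspan
  simp only [Fintype.card_fin] at hrank
  omega

lemma IsCorrespondence.exists_injective_zeros (hf : IsCorrespondence d f) (hsq : Squarefree f) :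
    ∃ (x : ℂ) (y : Fin d → ℂ), Function.Injective y ∧ ∀ i, f.evalEval x (y i) = 0 := by
  obtain ⟨x, hnodup, hcard⟩ := ((eventually_nodup_roots_map hsq).and hf.generic_left).exists
  have hroot (y : {y // y ∈ (f.map (evalRingHom x)).roots.toFinset}) : f.evalEval x y = 0 := by
    rw [← map_evalRingHom_eval]
    exact (mem_roots'.1 (Multiset.mem_toFinset.1 y.2)).2
  let e := Finset.equivFinOfCardEq ((Multiset.toFinset_card_of_nodup hnodup).trans hcard)
  exact ⟨x, fun i => e.symm i, Subtype.val_injective.comp e.symm.injective, fun i => hroot _⟩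

lemma IsMapOfTuples.rank_le_two (hf : IsMapOfTuples d f) (hd : d ≠ 0) (hsq : Squarefree f) :
    (ascCoeffMatrix d f).rank ≤ 2 := by
  obtain ⟨x, y, hy, hxy⟩ := hf.isCorrespondence.exists_injective_zeros hsq
  exact hf.rank_le_two_of_injective hd hy hxy

end RankTwo

section Components

variable {d : ℕ} {f p q : ℂ[X][Y]}

lemma IsCorrespondence.natDegree_ne_zero_of_dvd (hf : IsCorrespondence d f)
    (hp : Irreducible p) (hpf : p ∣ f) : p.natDegree ≠ 0 := by
  intro h0
  obtain ⟨r, rfl⟩ := natDegree_eq_zero.1 h0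
  obtain ⟨a, ha⟩ := IsAlgClosed.exists_root r fun h =>
    hp.not_isUnit ((Polynomial.isUnit_iff_degree_eq_zero.2 h).map C)
  apply hf.sliceLeft_ne_zero (a : OnePoint ℂ)
  obtain ⟨g, rfl⟩ := hpf
  rw [hf.sliceLeft_coe, Polynomial.map_mul, map_C, coe_evalRingHom, ha, C_0, zero_mul]

lemma IsCorrespondence.eventually_count_preimageList [DecidableEq (OnePoint ℂ)]
    (hf : IsCorrespondence d f) (hp : Irreducible p) (hpf : p ∣ f) :
    ∀ᶠ x : ℂ in cofinite, ∃ y : ℂ, (y : OnePoint ℂ) ∈ imageList d f x ∧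
      (preimageList d f y).count (x : OnePoint ℂ) = multiplicity p f := by
  have hp0 := hf.natDegree_ne_zero_of_dvd hp hpf
  have hp0' := hf.swap.natDegree_ne_zero_of_dvd (irreducible_swap hp)
    ((map_dvd_iff (Bivariate.swap (R := ℂ))).2 hpf)
  filter_upwards [eventually_exists_evalEval_eq_zero hp0,
    eventually_rootMultiplicity_eval_eq hp hp0' hf.ne_zero] with x ⟨y, hy⟩ hx
  refine ⟨y, ?_, ?_⟩
  · obtain ⟨g, rfl⟩ := hpf
    rw [hf.coe_mem_imageList, evalEval_mul, hy, zero_mul]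
  · rw [preimageList, count_coe_sphereRoots, hf.sliceRight_coe, hx y hy]

lemma IsMapOfTuples.multiplicity_eq (hf : IsMapOfTuples d f) (hp : Irreducible p) (hpf : p ∣ f)
    (hq : Irreducible q) (hqf : q ∣ f) : multiplicity p f = multiplicity q f := by
  classical
  obtain ⟨x, ⟨y, hy, hpy⟩, z, hz, hqz⟩ :=
    ((hf.isCorrespondence.eventually_count_preimageList hp hpf).and
      (hf.isCorrespondence.eventually_count_preimageList hq hqf)).exists
  rw [← hpy, ← hqz, hf.left x y hy z hz]

lemma IsMapOfTuples.exists_multiplicity_eq (hf : IsMapOfTuples d f) (hd : d ≠ 0) :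
    ∃ e ≠ 0, ∀ p, Irreducible p → p ∣ f → multiplicity p f = e := by
  have hc := hf.isCorrespondence
  have hunit : ¬ IsUnit f := fun h => hd (by rw [← hc.natDegree, natDegree_eq_zero_of_isUnit h])
  obtain ⟨q, hq, hqf⟩ := WfDvdMonoid.exists_irreducible_factor hunit hc.ne_zero
  exact ⟨multiplicity q f, multiplicity_ne_zero.2 hqf, fun p hp hpf =>
    hf.multiplicity_eq hp hpf hq hqf⟩

end Components

end TupleCorrespondence

theorem theorem2p4 (d : ℕ) (hd : 2 ≤ d) (f : ℂ[X][Y])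
    (hf : TupleCorrespondence.IsCorrespondence d f) :
    TupleCorrespondence.IsMapOfTuples d f ↔
      (∃ k : ℕ, k ∣ d ∧ k ≠ d ∧
        ∃ g : ℂ[X][Y], TupleCorrespondence.IsMapOfTuples k g ∧ f = g ^ (d / k)) ∨
      (TupleCorrespondence.coeffMatrix d f).rank = 2 := by
  have hd0 : d ≠ 0 := by omega
  rw [TupleCorrespondence.rank_coeffMatrix]
  constructor
  · intro h
    obtain ⟨e, he, hmult⟩ := h.exists_multiplicity_eq hd0
    obtain rfl | he1 := eq_or_ne e 1
    · have hsq := TupleCorrespondence.squarefree_of_multiplicity_eq_one hf.ne_zero hmult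
      exact .inr ((h.rank_le_two hd0 hsq).antisymm (hf.two_le_rank hd0))
    · obtain ⟨g, rfl⟩ := TupleCorrespondence.exists_eq_pow_of_multiplicity_eq hf.ne_zero he hmult
      obtain rfl : e * g.natDegree = d := by rw [← natDegree_pow, hf.natDegree]
      have hk := right_ne_zero_of_mul hd0
      refine .inl ⟨g.natDegree, dvd_mul_left _ _, ?_, g,
        (TupleCorrespondence.isMapOfTuples_pow_iff he).1 h, ?_⟩
      · exact fun h => he1 ((right_eq_mul₀ hk).1 h)
      · rw [Nat.mul_div_cancel _ (Nat.pos_of_ne_zero hk)]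
  · rintro (⟨k, ⟨e, rfl⟩, -, g, hg, rfl⟩ | hr)
    · rw [Nat.mul_div_cancel_left _ (Nat.pos_of_ne_zero (left_ne_zero_of_mul hd0)), mul_comm]
      exact (TupleCorrespondence.isMapOfTuples_pow_iff (right_ne_zero_of_mul hd0)).2 hg
    · exact hf.isMapOfTuples_of_rank_le_two hr.le
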